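/- Let $G\rightrightarrows Q$ and $G'\rightrightarrows Q'$ be (smooth, finite-dimensional) Lie groupoids with source and target maps $\alpha,\beta$ and $\alpha',\beta'$. Write $G_2=\{(g,h)\in G\times G:\beta(g)=\alpha(h)\}$ for the manifold of composable pairs, and let $$\mathcal P^\alpha G=\{(g,h,r)\in G^3:\ \alpha(g)=\alpha(h),\ \beta(h)=\alpha(r)\}\rightrightarrows G$$ be the prolongation of $G$ over its source map: the Lie groupoid with source $(g,h,r)\mapsto g$, target $(g,h,r)\mapsto r$ and product $(g,h,r)(r,h',r')=(g,hh',r')$. Let $i:G_2\hookrightarrow\mathcal P^\alpha G$, $i(g,h)=(g,g,h)$; through $i$ we regard $G_2$ as a subset of $\mathcal P^\alpha G$. For a differentiable function $L_d:G_2\to\mathbb R$ put $$\Sigma_{L_d}=\{\mu\in T^*(\mathcal P^\alpha G):\ \mu\text{ is based at a point of } i(G_2)\text{ and } i^*\mu=dL_d\}.$$ For a Lie groupoid $\Gamma\rightrightarrows M$ with source $a$, target $b$ and unit map $\epsilon$, let $A_x\Gamma=T_{\epsilon(x)}\big(a^{-1}(x)\big)$ and let $\tilde\alpha,\tilde\beta:T^*\Gamma\to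 A^*\Gamma$ be the source and target maps of the cotangent groupoid: for $\mu\in T^*_\xi\Gamma$, $\tilde\alpha(\mu)\in A^*_{a(\xi)}\Gamma$ and $\tilde\beta(\mu)\in A^*_{b(\xi)}\Gamma$ are $$\langle\tilde\alpha(\mu),v\rangle=-\langle\mu,T(r_\xi\circ\mathrm{inv})(v)\rangle,\qquad \langle\tilde\beta(\mu),w\rangle=\langle\mu,T\ell_\xi(w)\rangle ,$$ where $\ell_\xi(\eta)=\xi\eta$ and $(r_\xi\circ\mathrm{inv})(\eta)=\eta^{-1}\xi$. Take $\Gamma=\mathcal P^\alpha G$. A sequence $\gamma_{(g_1,g_2)},\dots,\gamma_{(g_{N-1},g_N)}$ in $T^*(\mathcal P^\alpha G)$, where $(g_k,g_{k+1})\in G_2$ and $\gamma_{(g_k,g_{k+1})}$ is a covector at $i(g_k,g_{k+1})$, satisfies the discrete second-order dynamics for $L_d$ if all its members lie in $\Sigma_{L_d}$ and $\tilde\alpha(\gamma_{(g_k,g_{k+1})})=\tilde\beta(\gamma_{(g_{k-1},g_k)})$ for $k=2,\dots,N-1$. The same notions are used for $G'$. Let $L_d:G_2\to\mathbb R$ and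 $L_d':G_2'\to\mathbb R$ be differentiable, and let $\chi:\mathcal P^\alpha G\to\mathcal P^{\alpha'}G'$ be a morphism of Lie groupoids (a smooth map that sends composable pairs to composable pairs and products to products) such that $G_2=\chi^{-1}(G_2')$ and $L_d=L_d'\circ\chi|_{G_2}$. Suppose that a sequence $\gamma'_{(g_1',g_2')},\dots,\gamma'_{(g_{N-1}',g_N')}$ in $T^*(\mathcal P^{\alpha'}G')$ satisfies the discrete second-order dynamics for $L_d'$, and that $\gamma_{(g_1,g_2)},\dots,\gamma_{(g_{N-1},g_N)}$, with $(g_k,g_{k+1})\in G_2$ and $\gamma_{(g_k,g_{k+1})}\in T^*_{i(g_k,g_{k+1})}(\mathcal P^\alpha G)$, is a $\chi^*$-related sequence: for every $k$, $\gamma'_{(g'_k,g'_{k+1})}$ is based at $\chi(i(g_k,g_{k+1}))$ and $$\langle\gamma_{(g_k,g_{k+1})},\xi\rangle=\langle\gamma'_{(g'_k,g'_{k+1})},T\chi(\xi)\rangle\quad\text{for all }\xi\in T_{i(g_k,g_{k+1})}(\mathcal P^\alpha G).$$ Then $\gamma_{(g_1,g_2)},\dots,\gamma_{(g_{N-1},g_N)}$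 satisfies the discrete second-order dynamics for $L_d$. -/

import Mathlib

open Manifold Set
open scoped ContDiff

noncomputable section

/-! ### Fibre products along a submersion -/

section FiberProduct

variable {EX EY EB : Type*}
  [NormedAddCommGroup EX] [NormedSpace ℝ EX] [NormedAddCommGroup EY] [NormedSpace ℝ EY]
  [NormedAddCommGroup EB] [NormedSpace ℝ EB]
  {X Y B : Type*} [TopologicalSpace X] [ChartedSpace EX X] [TopologicalSpace Y] [ChartedSpace EY Y]
  [TopologicalSpace B] [ChartedSpace EB B]

/-- The fibre product `X ×_B Y = {(x, y) | f x = p y}` of a smooth map `f : X → B` and a smooth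
submersion `p : Y → B`. -/
@[ext]
structure FiberProduct {f : X → B} {p : Y → B} (hf : ContMDiff 𝓘(ℝ, EX) 𝓘(ℝ, EB) ∞ f)
    (hp : IsSubmersion 𝓘(ℝ, EY) 𝓘(ℝ, EB) ∞ p) where
  fst : X
  snd : Y
  eq : f fst = p snd

namespace FiberProduct

variable {f : X → B} {p : Y → B} {hf : ContMDiff 𝓘(ℝ, EX) 𝓘(ℝ, EB) ∞ f}
  {hp : IsSubmersion 𝓘(ℝ, EY) 𝓘(ℝ, EB) ∞ p}

/-- The inclusion into the product. -/
def toProd (z : FiberProduct hf hp) : X × Y := (z.fst, z.snd)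

/-- The subspace topology of `X × Y`. -/
instance : TopologicalSpace (FiberProduct hf hp) := TopologicalSpace.induced toProd inferInstance

theorem continuous_toProd : Continuous (toProd : FiberProduct hf hp → X × Y) :=
  continuous_induced_dom

theorem continuous_fst : Continuous (fst : FiberProduct hf hp → X) :=
  _root_.continuous_fst.comp continuous_toProd

theorem continuous_snd : Continuous (snd : FiberProduct hf hp → Y) :=
  _root_.continuous_snd.comp continuous_toProd

/-- Near `y`, the submersion `p` is a linear projection `EB × F → EB` in suitable charts. -/
theorem normalForm (hp : IsSubmersion 𝓘(ℝ, EY) 𝓘(ℝ, EB) ∞ p) (y : Y) :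
    IsSubmersionAtOfComplement hp.complement 𝓘(ℝ, EY) 𝓘(ℝ, EB) ∞ p y :=
  hp.isSubmersionOfComplement_complement y

/-- The chart of `Y` in a normal form of the submersion `p` near `y`. -/
abbrev domC (hp : IsSubmersion 𝓘(ℝ, EY) 𝓘(ℝ, EB) ∞ p) (y : Y) : OpenPartialHomeomorph Y EY :=
  (normalForm hp y).domChart

/-- The chart of `B` in a normal form of the submersion `p` near `y`. -/
abbrev codC (hp : IsSubmersion 𝓘(ℝ, EY) 𝓘(ℝ, EB) ∞ p) (y : Y) : OpenPartialHomeomorph B EB :=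
  (normalForm hp y).codChart

/-- The splitting of the model space in a normal form of the submersion `p` near `y`. -/
abbrev splitC (hp : IsSubmersion 𝓘(ℝ, EY) 𝓘(ℝ, EB) ∞ p) (y : Y) :
    EY ≃L[ℝ] (EB × hp.complement) :=
  (normalForm hp y).equiv

section chart

variable (ψ : OpenPartialHomeomorph X EX) (z : FiberProduct hf hp)

/-- The domain of the inverse of the chart `chartOf ψ z`. -/
def chartTarget : Set (EX × hp.complement) :=
  {t | (t.1 ∈ ψ.target ∧ f (ψ.symm t.1) ∈ (codC hp z.snd).source) ∧
    (splitC hp z.snd).symm (codC hp z.snd (f (ψ.symm t.1)), t.2) ∈ (domC hp z.snd).target}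

/-- The `Y`-component of the inverse of the chart `chartOf ψ z`. -/
def chartSymmSnd (t : EX × hp.complement) : Y :=
  (domC hp z.snd).symm ((splitC hp z.snd).symm (codC hp z.snd (f (ψ.symm t.1)), t.2))

theorem codC_eq (hp : IsSubmersion 𝓘(ℝ, EY) 𝓘(ℝ, EB) ∞ p) (y₀ : Y) {y : Y}
    (hy : y ∈ (domC hp y₀).source) :
    codC hp y₀ (p y) = (splitC hp y₀ (domC hp y₀ y)).1 := by
  have hm : domC hp y₀ y ∈ ((domC hp y₀).extend 𝓘(ℝ, EY)).target := by
    simpa using (domC hp y₀).map_source hy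
  have h := (normalForm hp y₀).writtenInCharts hm
  simpa [(domC hp y₀).left_inv hy] using h

theorem chartSymm_eq {t : EX × hp.complement} (ht : t ∈ chartTarget ψ z) :
    f (ψ.symm t.1) = p (chartSymmSnd ψ z t) := by
  obtain ⟨⟨h1, h2⟩, h3⟩ := ht
  have hy := (domC hp z.snd).map_target h3
  have h := codC_eq hp z.snd hy
  rw [(domC hp z.snd).right_inv h3, ContinuousLinearEquiv.apply_symm_apply] at h
  exact ((codC hp z.snd).injOn
    ((normalForm hp z.snd).source_subset_preimage_source hy) h2 h).symm

theorem isOpen_preTarget :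
    IsOpen {t : EX × hp.complement | t.1 ∈ ψ.target ∧ f (ψ.symm t.1) ∈ (codC hp z.snd).source} := by
  have h : IsOpen (ψ.target ∩ ψ.symm ⁻¹' (f ⁻¹' (codC hp z.snd).source)) :=
    ψ.symm.isOpen_inter_preimage (hf.continuous.isOpen_preimage _ (codC hp z.snd).open_source)
  exact h.preimage _root_.continuous_fst

theorem continuousOn_pre :
    ContinuousOn (fun t : EX × hp.complement =>
      (splitC hp z.snd).symm (codC hp z.snd (f (ψ.symm t.1)), t.2))
      {t | t.1 ∈ ψ.target ∧ f (ψ.symm t.1) ∈ (codC hp z.snd).source} := by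
  refine (splitC hp z.snd).symm.continuous.comp_continuousOn
    (ContinuousOn.prodMk ?_ _root_.continuous_snd.continuousOn)
  refine (codC hp z.snd).continuousOn.comp (t := (codC hp z.snd).source) ?_ (fun t ht => ht.2)
  exact hf.continuous.comp_continuousOn (ψ.continuousOn_symm.comp
    _root_.continuous_fst.continuousOn (fun t ht => ht.1))

theorem isOpen_chartTarget : IsOpen (chartTarget ψ z) :=
  (continuousOn_pre ψ z).isOpen_inter_preimage (isOpen_preTarget ψ z) (domC hp z.snd).open_target

open Classical in
/-- The chart of the fibre product near `z` built from a chart `ψ` of `X`: in a chart of `Y` in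
which the submersion is a linear projection `EB × F → EB`, it sends `(x, y)` to
`(ψ x, F-coordinate of y)`. -/
def chartOf : OpenPartialHomeomorph (FiberProduct hf hp) (EX × hp.complement) where
  toFun w := (ψ w.fst, (splitC hp z.snd (domC hp z.snd w.snd)).2)
  invFun t := if h : t ∈ chartTarget ψ z then ⟨ψ.symm t.1, chartSymmSnd ψ z t, chartSymm_eq ψ z h⟩
    else z
  source := {w | w.fst ∈ ψ.source ∧ w.snd ∈ (domC hp z.snd).source}
  target := chartTarget ψ z
  map_source' w hw := by
    have h1 : f w.fst ∈ (codC hp z.snd).source := by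
      rw [w.eq]; exact (normalForm hp z.snd).source_subset_preimage_source hw.2
    refine ⟨⟨ψ.map_source hw.1, by simpa [ψ.left_inv hw.1] using h1⟩, ?_⟩
    simpa [ψ.left_inv hw.1, w.eq, codC_eq hp z.snd hw.2] using (domC hp z.snd).map_source hw.2
  map_target' t ht := by
    simp only [ht, dite_true, mem_ofPred_eq]
    exact ⟨ψ.map_target ht.1.1, (domC hp z.snd).map_target ht.2⟩
  left_inv' w hw := by
    have h1 : f w.fst ∈ (codC hp z.snd).source := by
      rw [w.eq]; exact (normalForm hp z.snd).source_subset_preimage_source hw.2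
    have h2 : (ψ w.fst, (splitC hp z.snd (domC hp z.snd w.snd)).2) ∈ chartTarget ψ z := by
      refine ⟨⟨ψ.map_source hw.1, by simpa [ψ.left_inv hw.1] using h1⟩, ?_⟩
      simpa [ψ.left_inv hw.1, w.eq, codC_eq hp z.snd hw.2] using (domC hp z.snd).map_source hw.2
    simp only [h2, dite_true]
    ext
    · exact ψ.left_inv hw.1
    · simp [chartSymmSnd, ψ.left_inv hw.1, w.eq, codC_eq hp z.snd hw.2,
        (domC hp z.snd).left_inv hw.2]
  right_inv' t ht := by
    simp only [ht, dite_true]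
    ext
    · exact ψ.right_inv ht.1.1
    · simp [chartSymmSnd, (domC hp z.snd).right_inv ht.2]
  open_source := (ψ.open_source.preimage continuous_fst).inter
    ((domC hp z.snd).open_source.preimage continuous_snd)
  open_target := isOpen_chartTarget ψ z
  continuousOn_toFun := by
    refine ContinuousOn.prodMk (ψ.continuousOn.comp continuous_fst.continuousOn fun w hw => hw.1) ?_
    exact (_root_.continuous_snd.comp (splitC hp z.snd).continuous).comp_continuousOn
      ((domC hp z.snd).continuousOn.comp continuous_snd.continuousOn fun w hw => hw.2)
  continuousOn_invFun := by
    have hi : Topology.IsInducing (toProd : FiberProduct hf hp → X × Y) := ⟨rfl⟩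
    rw [hi.continuousOn_iff]
    have h1 : ContinuousOn (fun t => (ψ.symm t.1, chartSymmSnd ψ z t)) (chartTarget ψ z) :=
      ContinuousOn.prodMk
        (ψ.continuousOn_symm.comp _root_.continuous_fst.continuousOn fun t ht => ht.1.1)
        ((domC hp z.snd).continuousOn_symm.comp
          ((continuousOn_pre ψ z).mono fun t ht => ht.1) fun t ht => ht.2)
    refine h1.congr fun t ht => ?_
    simp [ht, toProd]

end chart

/-- The smooth structure of the fibre product: that of an embedded submanifold of `X × Y`. It is
characterised by `contMDiff_fst`, `contMDiff_snd` and `contMDiff_mk` below. -/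
instance [IsManifold 𝓘(ℝ, EX) ∞ X] : ChartedSpace (EX × hp.complement) (FiberProduct hf hp) where
  atlas := {c | ∃ ψ ∈ IsManifold.maximalAtlas 𝓘(ℝ, EX) ∞ X, ∃ z, c = chartOf ψ z}
  chartAt z := chartOf (chartAt EX z.fst) z
  mem_chart_source z := ⟨mem_chart_source EX z.fst, (normalForm hp z.snd).mem_domChart_source⟩
  chart_mem_atlas z := ⟨_, IsManifold.chart_mem_maximalAtlas z.fst, z, rfl⟩


section smooth

variable {ψ : OpenPartialHomeomorph X EX}

theorem chartOf_symm {z : FiberProduct hf hp} {t : EX × hp.complement}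
    (ht : t ∈ chartTarget ψ z) :
    (chartOf ψ z).symm t = ⟨ψ.symm t.1, chartSymmSnd ψ z t, chartSymm_eq ψ z ht⟩ :=
  dif_pos ht

theorem chartOf_symm_fst {z : FiberProduct hf hp} {t : EX × hp.complement}
    (ht : t ∈ (chartOf ψ z).target) : ((chartOf ψ z).symm t).fst = ψ.symm t.1 := by
  rw [chartOf_symm ht]

theorem chartOf_symm_snd {z : FiberProduct hf hp} {t : EX × hp.complement}
    (ht : t ∈ (chartOf ψ z).target) : ((chartOf ψ z).symm t).snd = chartSymmSnd ψ z t := by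
  rw [chartOf_symm ht]

theorem contMDiffOn_chartOf_symm_fst (hψ : ψ ∈ IsManifold.maximalAtlas 𝓘(ℝ, EX) ∞ X)
    (z : FiberProduct hf hp) :
    ContMDiffOn 𝓘(ℝ, EX × hp.complement) 𝓘(ℝ, EX) ∞
      (fun t => ((chartOf ψ z).symm t).fst) (chartOf ψ z).target := by
  have h1 : ContMDiffOn 𝓘(ℝ, EX × hp.complement) 𝓘(ℝ, EX) ∞ (fun t => ψ.symm t.1)
      (chartOf ψ z).target :=
    (contMDiffOn_symm_of_mem_maximalAtlas hψ).comp
      contDiff_fst.contMDiff.contMDiffOn fun t ht => ht.1.1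
  exact h1.congr fun t ht => chartOf_symm_fst ht

theorem contMDiffOn_chartOf_symm_snd (hψ : ψ ∈ IsManifold.maximalAtlas 𝓘(ℝ, EX) ∞ X)
    (z : FiberProduct hf hp) :
    ContMDiffOn 𝓘(ℝ, EX × hp.complement) 𝓘(ℝ, EY) ∞
      (fun t => ((chartOf ψ z).symm t).snd) (chartOf ψ z).target := by
  have h1 : ContMDiffOn 𝓘(ℝ, EX × hp.complement) 𝓘(ℝ, EX) ∞ (fun t => ψ.symm t.1)
      (chartOf ψ z).target :=
    (contMDiffOn_symm_of_mem_maximalAtlas hψ).comp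
      contDiff_fst.contMDiff.contMDiffOn fun t ht => ht.1.1
  have h2 : ContMDiffOn 𝓘(ℝ, EX × hp.complement) 𝓘(ℝ, EB) ∞
      (fun t => codC hp z.snd (f (ψ.symm t.1))) (chartOf ψ z).target :=
    (contMDiffOn_of_mem_maximalAtlas (normalForm hp z.snd).codChart_mem_maximalAtlas).comp
      (hf.comp_contMDiffOn h1) fun t ht => ht.1.2
  have h3 : ContMDiffOn 𝓘(ℝ, EX × hp.complement) 𝓘(ℝ, EY) ∞
      (fun t => (splitC hp z.snd).symm (codC hp z.snd (f (ψ.symm t.1)), t.2))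
      (chartOf ψ z).target :=
    (splitC hp z.snd).symm.contDiff.contMDiff.comp_contMDiffOn
      (h2.prodMk_space contDiff_snd.contMDiff.contMDiffOn)
  have h4 : ContMDiffOn 𝓘(ℝ, EX × hp.complement) 𝓘(ℝ, EY) ∞ (chartSymmSnd ψ z)
      (chartOf ψ z).target :=
    (contMDiffOn_symm_of_mem_maximalAtlas (normalForm hp z.snd).domChart_mem_maximalAtlas).comp
      h3 fun t ht => ht.2
  exact h4.congr fun t ht => chartOf_symm_snd ht

theorem contMDiffWithinAt_chartOf (hψ : ψ ∈ IsManifold.maximalAtlas 𝓘(ℝ, EX) ∞ X)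
    (z : FiberProduct hf hp) {EM HM M : Type*} [NormedAddCommGroup EM] [NormedSpace ℝ EM]
    [TopologicalSpace HM] {I : ModelWithCorners ℝ EM HM} [TopologicalSpace M] [ChartedSpace HM M]
    {s : Set M} {m : M} {h : M → FiberProduct hf hp}
    (h1 : ContMDiffWithinAt I 𝓘(ℝ, EX) ∞ (fun m => (h m).fst) s m)
    (h2 : ContMDiffWithinAt I 𝓘(ℝ, EY) ∞ (fun m => (h m).snd) s m)
    (hm : h m ∈ (chartOf ψ z).source) :
    ContMDiffWithinAt I 𝓘(ℝ, EX × hp.complement) ∞ (fun m => chartOf ψ z (h m)) s m := by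
  have h3 := (contMDiffAt_of_mem_maximalAtlas hψ hm.1).comp_contMDiffWithinAt m h1
  have h4 := (contMDiffAt_of_mem_maximalAtlas
    (normalForm hp z.snd).domChart_mem_maximalAtlas hm.2).comp_contMDiffWithinAt m h2
  have h5 := (contDiff_snd.comp
    (splitC hp z.snd).contDiff).contMDiff.contMDiffAt.comp_contMDiffWithinAt m h4
  exact h3.prodMk_space h5

variable [IsManifold 𝓘(ℝ, EX) ∞ X]

instance : IsManifold 𝓘(ℝ, EX × hp.complement) ∞ (FiberProduct hf hp) := by
  refine isManifold_of_contDiffOn _ _ _ ?_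
  rintro _ _ ⟨ψ₁, hψ₁, z₁, rfl⟩ ⟨ψ₂, hψ₂, z₂, rfl⟩
  simp only [mfld_simps]
  rw [← contMDiffOn_iff_contDiffOn]
  intro t ht
  exact contMDiffWithinAt_chartOf hψ₂ z₂
    (((contMDiffOn_chartOf_symm_fst hψ₁ z₁) t ht.1).mono fun t ht => ht.1)
    (((contMDiffOn_chartOf_symm_snd hψ₁ z₁) t ht.1).mono fun t ht => ht.1) ht.2

theorem chartOf_mem_maximalAtlas (hψ : ψ ∈ IsManifold.maximalAtlas 𝓘(ℝ, EX) ∞ X)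
    (z : FiberProduct hf hp) :
    chartOf ψ z ∈ IsManifold.maximalAtlas 𝓘(ℝ, EX × hp.complement) ∞ (FiberProduct hf hp) :=
  IsManifold.subset_maximalAtlas ⟨ψ, hψ, z, rfl⟩

theorem contMDiff_fst :
    ContMDiff 𝓘(ℝ, EX × hp.complement) 𝓘(ℝ, EX) ∞ (fst : FiberProduct hf hp → X) := by
  intro z
  have hc := IsManifold.chart_mem_maximalAtlas (I := 𝓘(ℝ, EX)) (n := ∞) z.fst
  have hz : z ∈ (chartOf (chartAt EX z.fst) z).source := mem_chart_source _ z
  have h := ((contMDiffOn_chartOf_symm_fst hc z).contMDiffAt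
    ((chartOf _ z).open_target.mem_nhds ((chartOf _ z).map_source hz))).comp z
    (contMDiffAt_of_mem_maximalAtlas (chartOf_mem_maximalAtlas hc z) hz)
  refine h.congr_of_eventuallyEq ?_
  filter_upwards [(chartOf _ z).open_source.mem_nhds hz] with w hw
  simp [(chartOf (chartAt EX z.fst) z).left_inv hw]

theorem contMDiff_snd :
    ContMDiff 𝓘(ℝ, EX × hp.complement) 𝓘(ℝ, EY) ∞ (snd : FiberProduct hf hp → Y) := by
  intro z
  have hc := IsManifold.chart_mem_maximalAtlas (I := 𝓘(ℝ, EX)) (n := ∞) z.fst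
  have hz : z ∈ (chartOf (chartAt EX z.fst) z).source := mem_chart_source _ z
  have h := ((contMDiffOn_chartOf_symm_snd hc z).contMDiffAt
    ((chartOf _ z).open_target.mem_nhds ((chartOf _ z).map_source hz))).comp z
    (contMDiffAt_of_mem_maximalAtlas (chartOf_mem_maximalAtlas hc z) hz)
  refine h.congr_of_eventuallyEq ?_
  filter_upwards [(chartOf _ z).open_source.mem_nhds hz] with w hw
  simp [(chartOf (chartAt EX z.fst) z).left_inv hw]

/-- A map into the fibre product is smooth as soon as its two components are. -/
theorem contMDiff_mk {EM HM M : Type*} [NormedAddCommGroup EM] [NormedSpace ℝ EM]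
    [TopologicalSpace HM] {I : ModelWithCorners ℝ EM HM} [TopologicalSpace M] [ChartedSpace HM M]
    {h : M → FiberProduct hf hp} (h1 : ContMDiff I 𝓘(ℝ, EX) ∞ (fun m => (h m).fst))
    (h2 : ContMDiff I 𝓘(ℝ, EY) ∞ (fun m => (h m).snd)) :
    ContMDiff I 𝓘(ℝ, EX × hp.complement) ∞ h := by
  have hcont : Continuous h := continuous_induced_rng.2 (h1.continuous.prodMk h2.continuous)
  intro m
  have hc := IsManifold.chart_mem_maximalAtlas (I := 𝓘(ℝ, EX)) (n := ∞) (h m).fst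
  have hz : h m ∈ (chartOf (chartAt EX (h m).fst) (h m)).source := mem_chart_source _ (h m)
  have h3 := (contMDiffAt_symm_of_mem_maximalAtlas (chartOf_mem_maximalAtlas hc (h m))
    ((chartOf _ (h m)).map_source hz)).comp m
    (contMDiffWithinAt_univ.1 (contMDiffWithinAt_chartOf hc (h m)
      (h1 m).contMDiffWithinAt (h2 m).contMDiffWithinAt hz))
  refine h3.congr_of_eventuallyEq ?_
  filter_upwards [hcont.continuousAt ((chartOf _ (h m)).open_source.mem_nhds hz)] with w hw
  exact ((chartOf (chartAt EX (h m).fst) (h m)).left_inv hw).symm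

/-- The composition of the first projection with a submersion is a submersion. -/
theorem isSubmersion_comp_fst {EC C : Type*} [NormedAddCommGroup EC] [NormedSpace ℝ EC]
    [TopologicalSpace C] [ChartedSpace EC C] {s : X → C}
    (hs : IsSubmersion 𝓘(ℝ, EX) 𝓘(ℝ, EC) ∞ s) :
    IsSubmersion 𝓘(ℝ, EX × hp.complement) 𝓘(ℝ, EC) ∞
      (fun z : FiberProduct hf hp => s z.fst) := by
  refine IsSubmersionOfComplement.isSubmersion (F := hs.complement × hp.complement) fun z => ?_
  have hd := (normalForm hs z.fst).domChart_mem_maximalAtlas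
  refine IsSubmersionAtOfComplement.mk_of_charts
    (((splitC hs z.fst).prodCongr (ContinuousLinearEquiv.refl ℝ hp.complement)).trans
      (ContinuousLinearEquiv.prodAssoc ℝ EC hs.complement hp.complement))
    (chartOf (domC hs z.fst) z) (codC hs z.fst)
    ⟨(normalForm hs z.fst).mem_domChart_source, (normalForm hp z.snd).mem_domChart_source⟩
    (normalForm hs z.fst).mem_codChart_source (chartOf_mem_maximalAtlas hd z)
    (normalForm hs z.fst).codChart_mem_maximalAtlas
    (fun w hw => (normalForm hs z.fst).source_subset_preimage_source hw.1) ?_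
  intro t ht
  have ht' : t ∈ (chartOf (domC hs z.fst) z).target := by simpa using ht
  have h1 : (domC hs z.fst).symm t.1 ∈ (domC hs z.fst).source :=
    (domC hs z.fst).map_target ht'.1.1
  have h2 := codC_eq hs z.fst h1
  rw [(domC hs z.fst).right_inv ht'.1.1] at h2
  simpa [chartOf_symm_fst ht'] using h2

end smooth

end FiberProduct

/-- The composition of a submersion with a diffeomorphism is a submersion. -/
theorem isSubmersion_comp_diffeomorph [IsManifold 𝓘(ℝ, EX) ∞ X] {s : X → B}
    (hs : IsSubmersion 𝓘(ℝ, EX) 𝓘(ℝ, EB) ∞ s) (d : X ≃ₘ^∞⟮𝓘(ℝ, EX), 𝓘(ℝ, EX)⟯ X) :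
    IsSubmersion 𝓘(ℝ, EX) 𝓘(ℝ, EB) ∞ (fun x => s (d x)) := by
  refine IsSubmersionOfComplement.isSubmersion (F := hs.complement) fun x => ?_
  have hn := FiberProduct.normalForm hs (d x)
  have hmem : d.toHomeomorph.transOpenPartialHomeomorph hn.domChart ∈
      IsManifold.maximalAtlas 𝓘(ℝ, EX) ∞ X := by
    refine OpenPartialHomeomorph.mem_maximalAtlas_of_contMDiffOn _ ?_ ?_
    · exact (contMDiffOn_of_mem_maximalAtlas hn.domChart_mem_maximalAtlas).comp
        d.contMDiff.contMDiffOn fun x hx => hx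
    · exact d.symm.contMDiff.comp_contMDiffOn
        (contMDiffOn_symm_of_mem_maximalAtlas hn.domChart_mem_maximalAtlas)
  refine IsSubmersionAtOfComplement.mk_of_charts hn.equiv
    (d.toHomeomorph.transOpenPartialHomeomorph hn.domChart) hn.codChart
    hn.mem_domChart_source hn.mem_codChart_source hmem hn.codChart_mem_maximalAtlas
    (fun w hw => hn.source_subset_preimage_source hw) ?_
  intro t ht
  have ht' : t ∈ (hn.domChart.extend 𝓘(ℝ, EX)).target := by simpa using ht
  have h := hn.writtenInCharts ht'
  simpa using h

end FiberProduct

/-! ### Lie groupoids -/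

/-- A Lie groupoid `G ⇉ Q`; arrows are composed from left to right, `mul ⟨g, h, _⟩ = gh` being
defined for `tgt g = src h`. -/
structure LieGroupoid (EG EQ G Q : Type*) [NormedAddCommGroup EG] [NormedSpace ℝ EG]
    [NormedAddCommGroup EQ] [NormedSpace ℝ EQ] [TopologicalSpace G] [ChartedSpace EG G]
    [IsManifold 𝓘(ℝ, EG) ∞ G] [TopologicalSpace Q] [ChartedSpace EQ Q] where
  src : G → Q
  tgt : G → Q
  src_submersion : IsSubmersion 𝓘(ℝ, EG) 𝓘(ℝ, EQ) ∞ src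
  tgt_submersion : IsSubmersion 𝓘(ℝ, EG) 𝓘(ℝ, EQ) ∞ tgt
  mul : FiberProduct tgt_submersion.contMDiff src_submersion → G
  one : Q → G
  inv : G → G
  contMDiff_mul : ContMDiff 𝓘(ℝ, EG × src_submersion.complement) 𝓘(ℝ, EG) ∞ mul
  contMDiff_one : ContMDiff 𝓘(ℝ, EQ) 𝓘(ℝ, EG) ∞ one
  contMDiff_inv : ContMDiff 𝓘(ℝ, EG) 𝓘(ℝ, EG) ∞ inv
  src_mul : ∀ z, src (mul z) = src z.fst
  tgt_mul : ∀ z, tgt (mul z) = tgt z.snd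
  mul_assoc : ∀ (g h k : G) (hgh : tgt g = src h) (hhk : tgt h = src k),
    mul ⟨mul ⟨g, h, hgh⟩, k, (tgt_mul ⟨g, h, hgh⟩).trans hhk⟩ =
      mul ⟨g, mul ⟨h, k, hhk⟩, hgh.trans (src_mul ⟨h, k, hhk⟩).symm⟩
  src_one : ∀ q, src (one q) = q
  tgt_one : ∀ q, tgt (one q) = q
  one_mul : ∀ g, mul ⟨one (src g), g, tgt_one _⟩ = g
  mul_one : ∀ g, mul ⟨g, one (tgt g), (src_one _).symm⟩ = g
  src_inv : ∀ g, src (inv g) = tgt g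
  tgt_inv : ∀ g, tgt (inv g) = src g
  mul_inv : ∀ g, mul ⟨g, inv g, (src_inv g).symm⟩ = one (src g)
  inv_mul : ∀ g, mul ⟨inv g, g, tgt_inv g⟩ = one (tgt g)

/-- The cotangent bundle `T*M`, as the type of all covectors of `M`. -/
abbrev Cotangent (E M : Type*) [NormedAddCommGroup E] [NormedSpace ℝ E] [TopologicalSpace M]
    [ChartedSpace E M] :=
  Bundle.TotalSpace (E →L[ℝ] ℝ) (fun x : M => TangentSpace 𝓘(ℝ, E) x →L[ℝ] ℝ)

namespace LieGroupoid

variable {EG EQ G Q : Type*} [NormedAddCommGroup EG] [NormedSpace ℝ EG]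
  [NormedAddCommGroup EQ] [NormedSpace ℝ EQ] [TopologicalSpace G] [ChartedSpace EG G]
  [IsManifold 𝓘(ℝ, EG) ∞ G] [TopologicalSpace Q] [ChartedSpace EQ Q]
  (𝓖 : LieGroupoid EG EQ G Q)

/-- The manifold `G₂` of composable pairs. -/
abbrev Composable := FiberProduct 𝓖.tgt_submersion.contMDiff 𝓖.src_submersion

/-- The `α`-fibre `α⁻¹(q)`, as the fibre product of `{q} → Q` and `α : G → Q`; a point of it is a
triple `(*, g, α(g) = q)`. -/
abbrev SrcFiber (q : Q) :=
  FiberProduct (contMDiff_const : ContMDiff 𝓘(ℝ, Unit) 𝓘(ℝ, EQ) ∞ fun _ : Unit => q)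
    𝓖.src_submersion

/-- The unit `ε(q)` as a point of the `α`-fibre of `q`. -/
def unitPoint (q : Q) : 𝓖.SrcFiber q := ⟨(), 𝓖.one q, (𝓖.src_one q).symm⟩

/-- The fibre `A_q G` of the Lie algebroid of `G`: the tangent space at `ε(q)` of the
`α`-fibre of `q`. -/
abbrev AlgebroidFiber (q : Q) : Type _ :=
  TangentSpace 𝓘(ℝ, Unit × 𝓖.src_submersion.complement) (𝓖.unitPoint q)

/-- The total space of the dual `A*G` of the Lie algebroid of `G`. -/
abbrev DualAlgebroid :=
  Bundle.TotalSpace ((Unit × 𝓖.src_submersion.complement) →L[ℝ] ℝ)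
    (fun q : Q => 𝓖.AlgebroidFiber q →L[ℝ] ℝ)

/-- The left translation `ℓ_g : α⁻¹(β(g)) → α⁻¹(α(g)) ⊆ G`, `h ↦ gh`. -/
def leftTranslation (g : G) : 𝓖.SrcFiber (𝓖.tgt g) → G :=
  fun h => 𝓖.mul ⟨g, h.snd, h.eq⟩

/-- The map `r_g ∘ i : α⁻¹(α(g)) → G`, `h ↦ h⁻¹g`. -/
def rightTranslationInv (g : G) : 𝓖.SrcFiber (𝓖.src g) → G :=
  fun h => 𝓖.mul ⟨𝓖.inv h.snd, g, (𝓖.tgt_inv h.snd).trans h.eq.symm⟩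

/-- The value at `g` of the left-invariant vector field of `v ∈ A_{β(g)} G`: `T ℓ_g (v)`. -/
def leftInvariant (g : G) : 𝓖.AlgebroidFiber (𝓖.tgt g) →L[ℝ] TangentSpace 𝓘(ℝ, EG) g :=
  mfderiv 𝓘(ℝ, Unit × 𝓖.src_submersion.complement) 𝓘(ℝ, EG) (𝓖.leftTranslation g)
    (𝓖.unitPoint (𝓖.tgt g))

/-- The tangent map `T (r_g ∘ i)` at the unit `ε(α(g))`. -/
def tangentRightInv (g : G) : 𝓖.AlgebroidFiber (𝓖.src g) →L[ℝ] TangentSpace 𝓘(ℝ, EG) g :=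
  mfderiv 𝓘(ℝ, Unit × 𝓖.src_submersion.complement) 𝓘(ℝ, EG) (𝓖.rightTranslationInv g)
    (𝓖.unitPoint (𝓖.src g))

/-- The value at `g` of the right-invariant vector field of `v ∈ A_{α(g)} G`:
`-T (r_g ∘ i) (v)`. -/
def rightInvariant (g : G) : 𝓖.AlgebroidFiber (𝓖.src g) →L[ℝ] TangentSpace 𝓘(ℝ, EG) g :=
  -𝓖.tangentRightInv g

/-- The source map of the cotangent groupoid `T*G ⇉ A*G`. -/
def cotangentSrc (μ : Cotangent EG G) : 𝓖.DualAlgebroid :=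
  ⟨𝓖.src μ.proj, μ.snd.comp (𝓖.rightInvariant μ.proj)⟩

/-- The target map of the cotangent groupoid `T*G ⇉ A*G`. -/
def cotangentTgt (μ : Cotangent EG G) : 𝓖.DualAlgebroid :=
  ⟨𝓖.tgt μ.proj, μ.snd.comp (𝓖.leftInvariant μ.proj)⟩

theorem mul_congr {a a' b b' : G} (ha : a = a') (hb : b = b') (h : 𝓖.tgt a = 𝓖.src b)
    (h' : 𝓖.tgt a' = 𝓖.src b') : 𝓖.mul ⟨a, b, h⟩ = 𝓖.mul ⟨a', b', h'⟩ := by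
  subst ha hb; rfl

theorem inv_inv (g : G) : 𝓖.inv (𝓖.inv g) = g := by
  have h4 : 𝓖.tgt (𝓖.inv g) = 𝓖.src g := 𝓖.tgt_inv g
  have h5 : 𝓖.tgt (𝓖.inv (𝓖.inv g)) = 𝓖.tgt g := by rw [𝓖.tgt_inv, 𝓖.src_inv]
  have h1 := 𝓖.mul_assoc (𝓖.inv (𝓖.inv g)) (𝓖.inv g) g (𝓖.tgt_inv _) (𝓖.tgt_inv g)
  have h2 := 𝓖.mul_congr ((𝓖.inv_mul (𝓖.inv g)).trans (congrArg 𝓖.one h4)) (rfl : g = g)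
    ((𝓖.tgt_mul _).trans h4) (𝓖.tgt_one _)
  have h3 := 𝓖.mul_congr (rfl : 𝓖.inv (𝓖.inv g) = _)
    ((𝓖.inv_mul g).trans (congrArg 𝓖.one h5.symm)) (by rw [𝓖.tgt_inv, 𝓖.src_mul])
    (𝓖.src_one _).symm
  exact (((𝓖.one_mul g).symm.trans (h2.symm.trans h1)).trans (h3.trans (𝓖.mul_one _))).symm

section Prolongation

variable {EP P : Type*} [NormedAddCommGroup EP] [NormedSpace ℝ EP] [TopologicalSpace P]
  [ChartedSpace EP P] [IsManifold 𝓘(ℝ, EP) ∞ P] {π : P → Q}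
  (hπ : IsSubmersion 𝓘(ℝ, EP) 𝓘(ℝ, EQ) ∞ π)

/-- The manifold `{(p, g) | π(p) = α(g)}`. -/
abbrev PreProlongation := FiberProduct hπ.contMDiff 𝓖.src_submersion

theorem contMDiff_tgt_snd : ContMDiff 𝓘(ℝ, EP × 𝓖.src_submersion.complement) 𝓘(ℝ, EQ) ∞
    (fun z : 𝓖.PreProlongation hπ => 𝓖.tgt z.snd) :=
  𝓖.tgt_submersion.contMDiff.comp FiberProduct.contMDiff_snd

/-- The manifold `{(p, g, p') | π(p) = α(g), β(g) = π(p')}`; its points are written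
`⟨⟨p, g, _⟩, p', _⟩`. -/
abbrev ProlongationSpace := FiberProduct (𝓖.contMDiff_tgt_snd hπ) hπ

/-- The model vector space of `𝓖.ProlongationSpace hπ`. -/
abbrev ProlongationModel := (EP × 𝓖.src_submersion.complement) × hπ.complement

/-- The inversion `(p, g, p') ↦ (p', g⁻¹, p)` of the prolongation. -/
def prolongationInv (z : 𝓖.ProlongationSpace hπ) : 𝓖.ProlongationSpace hπ :=
  ⟨⟨z.snd, 𝓖.inv z.fst.snd, z.eq.symm.trans (𝓖.src_inv _).symm⟩, z.fst.fst,
    (𝓖.tgt_inv _).trans z.fst.eq.symm⟩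

theorem contMDiff_prolongationInv : ContMDiff 𝓘(ℝ, 𝓖.ProlongationModel hπ)
    𝓘(ℝ, 𝓖.ProlongationModel hπ) ∞ (𝓖.prolongationInv hπ) :=
  FiberProduct.contMDiff_mk
    (FiberProduct.contMDiff_mk FiberProduct.contMDiff_snd
      (𝓖.contMDiff_inv.comp (FiberProduct.contMDiff_snd.comp FiberProduct.contMDiff_fst)))
    (FiberProduct.contMDiff_fst.comp FiberProduct.contMDiff_fst)

theorem prolongationInv_prolongationInv (z : 𝓖.ProlongationSpace hπ) :
    𝓖.prolongationInv hπ (𝓖.prolongationInv hπ z) = z := by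
  obtain ⟨⟨p, g, h⟩, p', h'⟩ := z
  simp [prolongationInv, 𝓖.inv_inv]

theorem prolongation_src_submersion :
    IsSubmersion 𝓘(ℝ, 𝓖.ProlongationModel hπ) 𝓘(ℝ, EP) ∞
      (fun z : 𝓖.ProlongationSpace hπ => z.fst.fst) :=
  FiberProduct.isSubmersion_comp_fst (FiberProduct.isSubmersion_comp_fst IsSubmersion.id)

theorem prolongation_tgt_submersion :
    IsSubmersion 𝓘(ℝ, 𝓖.ProlongationModel hπ) 𝓘(ℝ, EP) ∞
      (fun z : 𝓖.ProlongationSpace hπ => z.snd) :=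
  isSubmersion_comp_diffeomorph (𝓖.prolongation_src_submersion hπ)
    { toFun := 𝓖.prolongationInv hπ
      invFun := 𝓖.prolongationInv hπ
      left_inv := 𝓖.prolongationInv_prolongationInv hπ
      right_inv := 𝓖.prolongationInv_prolongationInv hπ
      contMDiff_toFun := 𝓖.contMDiff_prolongationInv hπ
      contMDiff_invFun := 𝓖.contMDiff_prolongationInv hπ }

/-- The prolongation `P^π G ⇉ P` of a Lie groupoid `G ⇉ Q` over a submersion `π : P → Q`: its
arrows are the triples `(p, g, p')` with `π(p) = α(g)`, `β(g) = π(p')`, and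
`(p, g, p')(p', h, p'') = (p, gh, p'')`. -/
def prolongation : LieGroupoid (𝓖.ProlongationModel hπ) EP (𝓖.ProlongationSpace hπ) P where
  src z := z.fst.fst
  tgt z := z.snd
  src_submersion := 𝓖.prolongation_src_submersion hπ
  tgt_submersion := 𝓖.prolongation_tgt_submersion hπ
  mul z := ⟨⟨z.fst.fst.fst, 𝓖.mul ⟨z.fst.fst.snd, z.snd.fst.snd,
      (z.fst.eq.trans (congrArg π z.eq)).trans z.snd.fst.eq⟩,
      by rw [𝓖.src_mul]; exact z.fst.fst.eq⟩, z.snd.snd, (𝓖.tgt_mul _).trans z.snd.eq⟩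
  one p := ⟨⟨p, 𝓖.one (π p), (𝓖.src_one _).symm⟩, p, 𝓖.tgt_one _⟩
  inv := 𝓖.prolongationInv hπ
  contMDiff_mul := by
    have h1 := FiberProduct.contMDiff_fst (hf := (𝓖.prolongation_tgt_submersion hπ).contMDiff)
      (hp := 𝓖.prolongation_src_submersion hπ)
    have h2 := FiberProduct.contMDiff_snd (hf := (𝓖.prolongation_tgt_submersion hπ).contMDiff)
      (hp := 𝓖.prolongation_src_submersion hπ)
    have h3 := FiberProduct.contMDiff_fst (hf := 𝓖.contMDiff_tgt_snd hπ) (hp := hπ)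
    have h4 := FiberProduct.contMDiff_snd (hf := 𝓖.contMDiff_tgt_snd hπ) (hp := hπ)
    have h5 := FiberProduct.contMDiff_fst (hf := hπ.contMDiff) (hp := 𝓖.src_submersion)
    have h6 := FiberProduct.contMDiff_snd (hf := hπ.contMDiff) (hp := 𝓖.src_submersion)
    refine FiberProduct.contMDiff_mk (FiberProduct.contMDiff_mk ?_ ?_) ?_
    · have h := h5.comp (h3.comp h1)
      exact h
    · exact 𝓖.contMDiff_mul.comp (FiberProduct.contMDiff_mk (h6.comp (h3.comp h1))
        (h6.comp (h3.comp h2)))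
    · have h := h4.comp h2
      exact h
  contMDiff_one := FiberProduct.contMDiff_mk (FiberProduct.contMDiff_mk contMDiff_id
    (𝓖.contMDiff_one.comp hπ.contMDiff)) contMDiff_id
  contMDiff_inv := 𝓖.contMDiff_prolongationInv hπ
  src_mul _ := rfl
  tgt_mul _ := rfl
  mul_assoc := by
    rintro ⟨⟨p, g, h1⟩, p₁, h2⟩ ⟨⟨q, h, h3⟩, q₁, h4⟩ ⟨⟨r, k, h5⟩, r₁, h6⟩ hgh hhk
    simp only [FiberProduct.mk.injEq, true_and, and_true]
    exact 𝓖.mul_assoc _ _ _ _ _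
  src_one _ := rfl
  tgt_one _ := rfl
  one_mul := by
    rintro ⟨⟨p, g, h1⟩, p₁, h2⟩
    simp only [FiberProduct.mk.injEq, true_and, and_true]
    exact (𝓖.mul_congr (congrArg 𝓖.one h1) rfl _ (𝓖.tgt_one _)).trans (𝓖.one_mul g)
  mul_one := by
    rintro ⟨⟨p, g, h1⟩, p₁, h2⟩
    simp only [FiberProduct.mk.injEq, true_and, and_true]
    exact (𝓖.mul_congr rfl (congrArg 𝓖.one h2.symm) _ (𝓖.src_one _).symm).trans (𝓖.mul_one g)
  src_inv _ := rfl
  tgt_inv _ := rfl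
  mul_inv := by
    rintro ⟨⟨p, g, h1⟩, p₁, h2⟩
    simp only [prolongationInv, FiberProduct.mk.injEq, true_and, and_true]
    exact (𝓖.mul_inv g).trans (congrArg 𝓖.one h1.symm)
  inv_mul := by
    rintro ⟨⟨p, g, h1⟩, p₁, h2⟩
    simp only [prolongationInv, FiberProduct.mk.injEq, true_and, and_true]
    exact (𝓖.inv_mul g).trans (congrArg 𝓖.one h2)

end Prolongation

/-- The space of arrows of the prolongation `P^α G` of `G` over its own source map. -/
abbrev SrcProlongationSpace := 𝓖.ProlongationSpace 𝓖.src_submersion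

/-- The model vector space of `P^α G`. -/
abbrev SrcProlongationModel := 𝓖.ProlongationModel 𝓖.src_submersion

/-- The Lie groupoid `P^α G ⇉ G`, the prolongation of `G` over its own source map. -/
abbrev srcProlongation :
    LieGroupoid 𝓖.SrcProlongationModel EG 𝓖.SrcProlongationSpace G :=
  𝓖.prolongation 𝓖.src_submersion

/-- The inclusion `G₂ → P^α G`, `(g, h) ↦ (g, g, h)`. -/
def inclComposable (z : 𝓖.Composable) : 𝓖.SrcProlongationSpace :=
  ⟨⟨z.fst, z.fst, rfl⟩, z.snd, z.eq⟩

/-- The set `Σ_L = {μ ∈ T*(P^α G) | i^* μ = dL}` generated by `L : G₂ → ℝ`, where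
`i : G₂ → P^α G` is the inclusion: the covectors `μ` at points `i(z)`, `z ∈ G₂`, with
`μ ∘ T_z i = dL(z)`. -/
def generatedSubmanifold (L : 𝓖.Composable → ℝ) :
    Set (Cotangent 𝓖.SrcProlongationModel 𝓖.SrcProlongationSpace) :=
  {μ | ∃ (z : 𝓖.Composable)
    (ν : TangentSpace 𝓘(ℝ, 𝓖.SrcProlongationModel) (𝓖.inclComposable z) →L[ℝ] ℝ),
    μ = ⟨𝓖.inclComposable z, ν⟩ ∧
      ∀ v : TangentSpace 𝓘(ℝ, EG × 𝓖.src_submersion.complement) z,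
        ν (mfderiv 𝓘(ℝ, EG × 𝓖.src_submersion.complement) 𝓘(ℝ, 𝓖.SrcProlongationModel)
            𝓖.inclComposable z v) =
          mfderiv 𝓘(ℝ, EG × 𝓖.src_submersion.complement) 𝓘(ℝ, ℝ) L z v}

/-- `γ` is a sequence of covectors `γ_{(g₁, g₂)}, …, γ_{(g_{N-1}, g_N)}`, `N = n + 1`:
consecutive points are composable, and the covectors are based at `(g_k, g_k, g_{k+1})`. -/
def IsSequenceOver {n : ℕ} (g : Fin (n + 1) → G)
    (γ : Fin n → Cotangent 𝓖.SrcProlongationModel 𝓖.SrcProlongationSpace) : Prop :=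
  ∀ k : Fin n, ∃ h : 𝓖.tgt (g k.castSucc) = 𝓖.src (g k.succ),
    (γ k).proj = 𝓖.inclComposable ⟨g k.castSucc, g k.succ, h⟩

/-- The discrete second-order dynamics of `L`: all `γ k` lie in `Σ_L` and consecutive ones are
composable in the cotangent groupoid `T*(P^α G) ⇉ A*(P^α G)`. -/
def SatisfiesDynamics (L : 𝓖.Composable → ℝ) {n : ℕ}
    (γ : Fin n → Cotangent 𝓖.SrcProlongationModel 𝓖.SrcProlongationSpace) : Prop :=
  (∀ k, γ k ∈ 𝓖.generatedSubmanifold L) ∧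
    ∀ k k' : Fin n, (k : ℕ) + 1 = k' →
      𝓖.srcProlongation.cotangentSrc (γ k') = 𝓖.srcProlongation.cotangentTgt (γ k)

variable {EG' EQ' G' Q' : Type*} [NormedAddCommGroup EG'] [NormedSpace ℝ EG']
  [NormedAddCommGroup EQ'] [NormedSpace ℝ EQ'] [TopologicalSpace G'] [ChartedSpace EG' G']
  [IsManifold 𝓘(ℝ, EG') ∞ G'] [TopologicalSpace Q'] [ChartedSpace EQ' Q']

/-- A morphism of Lie groupoids: a smooth map sending composable pairs to composable pairs and
products to products. -/
structure Hom (𝓖 : LieGroupoid EG EQ G Q) (𝓖' : LieGroupoid EG' EQ' G' Q') where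
  toFun : G → G'
  contMDiff_toFun : ContMDiff 𝓘(ℝ, EG) 𝓘(ℝ, EG') ∞ toFun
  composable : ∀ z : 𝓖.Composable, 𝓖'.tgt (toFun z.fst) = 𝓖'.src (toFun z.snd)
  map_mul : ∀ z : 𝓖.Composable,
    toFun (𝓖.mul z) = 𝓖'.mul ⟨toFun z.fst, toFun z.snd, composable z⟩

end LieGroupoid

/-- Covectors `μ ∈ T*_x M` and `μ' ∈ T*_{χ(x)} M'` are `χ^*`-related if `μ = μ' ∘ T_x χ`. -/
def CotangentRelated {E M E' M' : Type*} [NormedAddCommGroup E] [NormedSpace ℝ E]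
    [TopologicalSpace M] [ChartedSpace E M] [NormedAddCommGroup E'] [NormedSpace ℝ E']
    [TopologicalSpace M'] [ChartedSpace E' M'] (χ : M → M') (μ : Cotangent E M)
    (μ' : Cotangent E' M') : Prop :=
  ∃ ν : TangentSpace 𝓘(ℝ, E') (χ μ.proj) →L[ℝ] ℝ, μ' = ⟨χ μ.proj, ν⟩ ∧
    ∀ ξ : TangentSpace 𝓘(ℝ, E) μ.proj, μ.snd ξ = ν (mfderiv 𝓘(ℝ, E) 𝓘(ℝ, E') χ μ.proj ξ)

end

/-! Both conditions that define the dynamics are natural under pull-back by a groupoid morphism χ.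

Membership in Σ_L: since χ sends i(G₂) into i'(G₂'), it restricts to a smooth map φ : G₂ → G₂' with
χ ∘ i = i' ∘ φ, and L = L' ∘ φ. For γ = χ^*γ' this gives i^*γ = φ^*(i'^*γ') = φ^*dL' = dL. This is
`mem_generatedSubmanifold_of_related`.

Matching of consecutive covectors: χ preserves products, hence units and inverses, so it intertwines
the translations ℓ and r ∘ inv of the two groupoids (`toFun_leftTranslationOf`,
`toFun_rightTranslationInvOf`). Let Aχ be the derivative at a unit of χ restricted to the α-fibre.
Differentiating at the unit gives α̃(χ^*μ') = α̃'(μ') ∘ Aχ and β̃(χ^*μ') = β̃'(μ') ∘ Aχ. An equality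
α̃'(μ') = β̃'(ν') therefore pulls back along the same map Aχ, provided the two base points agree in
the domain of χ (`cotangentSrc_eq_cotangentTgt`). They do: the target of (g, g, h) and the source of
(h, h, k) are both h. -/

namespace LieGroupoid

/-! ### Units, inverses and translations in a Lie groupoid. -/

section Translations

variable {EG EQ G Q : Type*} [NormedAddCommGroup EG] [NormedSpace ℝ EG]
  [NormedAddCommGroup EQ] [NormedSpace ℝ EQ] [TopologicalSpace G] [ChartedSpace EG G]
  [IsManifold 𝓘(ℝ, EG) ∞ G] [TopologicalSpace Q] [ChartedSpace EQ Q]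
  (𝓖 : LieGroupoid EG EQ G Q)

/-- Compare the two bracketings of k g g⁻¹. The factors are replaced through `mul_congr` because the
composability proof inside a product depends on them. -/
theorem eq_inv_of_mul_eq_one (g k : G) (h : 𝓖.tgt k = 𝓖.src g)
    (hg : 𝓖.mul ⟨k, g, h⟩ = 𝓖.one (𝓖.tgt g)) : k = 𝓖.inv g := by
  have h0 : 𝓖.tgt k = 𝓖.src (𝓖.mul ⟨g, 𝓖.inv g, (𝓖.src_inv g).symm⟩) := by
    rw [𝓖.src_mul]; exact h
  have h1 := 𝓖.mul_assoc k g (𝓖.inv g) h (𝓖.src_inv g).symm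
  have h2 := 𝓖.mul_congr (hg.trans (congrArg 𝓖.one (𝓖.src_inv g).symm)) (rfl : 𝓖.inv g = _)
    ((𝓖.tgt_mul _).trans (𝓖.src_inv g).symm) (𝓖.tgt_one _)
  have h3 := 𝓖.mul_congr (rfl : k = _) ((𝓖.mul_inv g).trans (congrArg 𝓖.one h.symm))
    h0 (𝓖.src_one _).symm
  exact (h3.trans (𝓖.mul_one k)).symm.trans (h1.symm.trans (h2.trans (𝓖.one_mul _)))

/-- Multiply g g = g by g⁻¹ on the right. The lemma yields preservation of units, which is not part
of the definition of `Hom`. -/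
theorem eq_one_of_mul_self (g : G) (h : 𝓖.tgt g = 𝓖.src g) (hg : 𝓖.mul ⟨g, g, h⟩ = g) :
    g = 𝓖.one (𝓖.src g) := by
  have h0 : 𝓖.tgt g = 𝓖.src (𝓖.mul ⟨g, 𝓖.inv g, (𝓖.src_inv g).symm⟩) := by
    rw [𝓖.src_mul]; exact h
  have h1 := 𝓖.mul_assoc g g (𝓖.inv g) h (𝓖.src_inv g).symm
  have h2 := 𝓖.mul_congr hg (rfl : 𝓖.inv g = _) ((𝓖.tgt_mul _).trans (𝓖.src_inv g).symm)
    (𝓖.src_inv g).symm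
  have h3 := 𝓖.mul_congr (rfl : g = _) ((𝓖.mul_inv g).trans (congrArg 𝓖.one h.symm))
    h0 (𝓖.src_one _).symm
  exact ((h3.trans (𝓖.mul_one g)).symm.trans h1.symm).trans (h2.trans (𝓖.mul_inv g))

theorem one_mul_one (q : Q) :
    𝓖.mul ⟨𝓖.one q, 𝓖.one q, (𝓖.tgt_one q).trans (𝓖.src_one q).symm⟩ = 𝓖.one q :=
  (𝓖.mul_congr rfl (congrArg 𝓖.one (𝓖.tgt_one q).symm) _ (𝓖.src_one _).symm).trans
    (𝓖.mul_one _)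

theorem inv_one (q : Q) : 𝓖.inv (𝓖.one q) = 𝓖.one q :=
  (𝓖.eq_inv_of_mul_eq_one _ _ _
    ((𝓖.one_mul_one q).trans (congrArg 𝓖.one (𝓖.tgt_one q).symm))).symm

/-- The left translation `h ↦ gh` on the `α`-fibre of a point `q` equal to `β(g)`. -/
def leftTranslationOf (g : G) {q : Q} (hq : 𝓖.tgt g = q) : 𝓖.SrcFiber q → G :=
  fun h => 𝓖.mul ⟨g, h.snd, hq.trans h.eq⟩

/-- The map `h ↦ h⁻¹g` on the `α`-fibre of a point `q` equal to `α(g)`. -/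
def rightTranslationInvOf (g : G) {q : Q} (hq : 𝓖.src g = q) : 𝓖.SrcFiber q → G :=
  fun h => 𝓖.mul ⟨𝓖.inv h.snd, g, (𝓖.tgt_inv h.snd).trans (h.eq.symm.trans hq.symm)⟩

theorem contMDiff_leftTranslationOf (g : G) {q : Q} (hq : 𝓖.tgt g = q) :
    ContMDiff 𝓘(ℝ, Unit × 𝓖.src_submersion.complement) 𝓘(ℝ, EG) ∞
      (𝓖.leftTranslationOf g hq) :=
  𝓖.contMDiff_mul.comp (FiberProduct.contMDiff_mk contMDiff_const FiberProduct.contMDiff_snd)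

theorem contMDiff_rightTranslationInvOf (g : G) {q : Q} (hq : 𝓖.src g = q) :
    ContMDiff 𝓘(ℝ, Unit × 𝓖.src_submersion.complement) 𝓘(ℝ, EG) ∞
      (𝓖.rightTranslationInvOf g hq) :=
  𝓖.contMDiff_mul.comp (FiberProduct.contMDiff_mk
    (𝓖.contMDiff_inv.comp FiberProduct.contMDiff_snd) contMDiff_const)

theorem leftTranslationOf_unitPoint (g : G) {q : Q} (hq : 𝓖.tgt g = q) :
    𝓖.leftTranslationOf g hq (𝓖.unitPoint q) = g := by
  subst hq
  exact 𝓖.mul_one g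

theorem rightTranslationInvOf_unitPoint (g : G) {q : Q} (hq : 𝓖.src g = q) :
    𝓖.rightTranslationInvOf g hq (𝓖.unitPoint q) = g := by
  subst hq
  exact (𝓖.mul_congr (𝓖.inv_one _) rfl _ (𝓖.tgt_one _)).trans (𝓖.one_mul g)

/-- The source of `μ` in the cotangent groupoid, computed in the algebroid fibre of a point `q`
equal to the source of the base point of `μ`. -/
theorem cotangentSrc_eq (μ : Cotangent EG G) {q : Q} (hq : 𝓖.src μ.proj = q) :
    𝓖.cotangentSrc μ = ⟨q, (show EG →L[ℝ] ℝ from μ.snd).comp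
      (-(show Unit × 𝓖.src_submersion.complement →L[ℝ] EG from
        mfderiv 𝓘(ℝ, Unit × 𝓖.src_submersion.complement) 𝓘(ℝ, EG)
          (𝓖.rightTranslationInvOf μ.proj hq) (𝓖.unitPoint q)))⟩ := by
  -- With q equal to the source itself, `rightTranslationInvOf` unfolds to `rightTranslationInv`,
  -- and the minus sign is that of `rightInvariant`.
  subst hq
  rfl

/-- The target of `μ` in the cotangent groupoid, computed in the algebroid fibre of a point `q`
equal to the target of the base point of `μ`. -/
theorem cotangentTgt_eq (μ : Cotangent EG G) {q : Q} (hq : 𝓖.tgt μ.proj = q) :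
    𝓖.cotangentTgt μ = ⟨q, (show EG →L[ℝ] ℝ from μ.snd).comp
      (show Unit × 𝓖.src_submersion.complement →L[ℝ] EG from
        mfderiv 𝓘(ℝ, Unit × 𝓖.src_submersion.complement) 𝓘(ℝ, EG)
          (𝓖.leftTranslationOf μ.proj hq) (𝓖.unitPoint q))⟩ := by
  subst hq
  rfl

end Translations

/-! ### Morphisms preserve units and inverses and intertwine translations. -/

namespace Hom

variable {EG EQ G Q EG' EQ' G' Q' : Type*} [NormedAddCommGroup EG] [NormedSpace ℝ EG]
  [NormedAddCommGroup EQ] [NormedSpace ℝ EQ] [TopologicalSpace G] [ChartedSpace EG G]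
  [IsManifold 𝓘(ℝ, EG) ∞ G] [TopologicalSpace Q] [ChartedSpace EQ Q]
  [NormedAddCommGroup EG'] [NormedSpace ℝ EG']
  [NormedAddCommGroup EQ'] [NormedSpace ℝ EQ'] [TopologicalSpace G'] [ChartedSpace EG' G']
  [IsManifold 𝓘(ℝ, EG') ∞ G'] [TopologicalSpace Q'] [ChartedSpace EQ' Q']
  {𝓖 : LieGroupoid EG EQ G Q} {𝓖' : LieGroupoid EG' EQ' G' Q'} (χ : Hom 𝓖 𝓖')

/-- The map of units induced by a morphism. -/
def base (q : Q) : Q' := 𝓖'.src (χ.toFun (𝓖.one q))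

/-- The arrow g is composable with the unit at its target, and χ preserves composability. -/
theorem tgt_toFun (g : G) : 𝓖'.tgt (χ.toFun g) = χ.base (𝓖.tgt g) :=
  χ.composable ⟨g, 𝓖.one (𝓖.tgt g), (𝓖.src_one _).symm⟩

theorem src_toFun (g : G) : 𝓖'.src (χ.toFun g) = χ.base (𝓖.src g) := by
  have h := χ.tgt_toFun (𝓖.one (𝓖.src g))
  rw [𝓖.tgt_one] at h
  exact (χ.composable ⟨𝓖.one (𝓖.src g), g, 𝓖.tgt_one _⟩).symm.trans h

/-- The image of a unit is idempotent, and an idempotent arrow is a unit. -/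
theorem toFun_one (q : Q) : χ.toFun (𝓖.one q) = 𝓖'.one (χ.base q) := by
  have h : 𝓖.tgt (𝓖.one q) = 𝓖.src (𝓖.one q) := (𝓖.tgt_one q).trans (𝓖.src_one q).symm
  exact 𝓖'.eq_one_of_mul_self _ (χ.composable ⟨_, _, h⟩)
    ((χ.map_mul ⟨_, _, h⟩).symm.trans (congrArg χ.toFun (𝓖.one_mul_one q)))

/-- The image of g⁻¹ is a left inverse of the image of g, and left inverses are unique. -/
theorem toFun_inv (g : G) : χ.toFun (𝓖.inv g) = 𝓖'.inv (χ.toFun g) := by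
  refine 𝓖'.eq_inv_of_mul_eq_one _ _ (χ.composable ⟨_, _, 𝓖.tgt_inv g⟩) ?_
  rw [← χ.map_mul ⟨_, _, 𝓖.tgt_inv g⟩, 𝓖.inv_mul, χ.toFun_one, χ.tgt_toFun]

/-- The restriction of a morphism to the `α`-fibres. -/
def fiberMap (q : Q) (h : 𝓖.SrcFiber q) : 𝓖'.SrcFiber (χ.base q) :=
  ⟨(), χ.toFun h.snd, (congrArg χ.base h.eq).trans (χ.src_toFun h.snd).symm⟩

theorem contMDiff_fiberMap (q : Q) :
    ContMDiff 𝓘(ℝ, Unit × 𝓖.src_submersion.complement)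
      𝓘(ℝ, Unit × 𝓖'.src_submersion.complement) ∞ (χ.fiberMap q) :=
  FiberProduct.contMDiff_mk contMDiff_const
    (χ.contMDiff_toFun.comp FiberProduct.contMDiff_snd)

/-- Makes the derivative of `fiberMap` at the unit a linear map Aχ between algebroid fibres. -/
theorem fiberMap_unitPoint (q : Q) :
    χ.fiberMap q (𝓖.unitPoint q) = 𝓖'.unitPoint (χ.base q) :=
  FiberProduct.ext rfl (χ.toFun_one q)

/-- Multiplicativity read on one α-fibre. Its derivative at the unit says that Tχ ∘ Tℓ_g = Tℓ_{χ(g)}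
∘ Aχ. -/
theorem toFun_leftTranslationOf (g : G) {q : Q} (hq : 𝓖.tgt g = q)
    (hq' : 𝓖'.tgt (χ.toFun g) = χ.base q) :
    χ.toFun ∘ 𝓖.leftTranslationOf g hq =
      𝓖'.leftTranslationOf (χ.toFun g) hq' ∘ χ.fiberMap q := by
  funext h
  exact χ.map_mul _

theorem toFun_rightTranslationInvOf (g : G) {q : Q} (hq : 𝓖.src g = q)
    (hq' : 𝓖'.src (χ.toFun g) = χ.base q) :
    χ.toFun ∘ 𝓖.rightTranslationInvOf g hq =
      𝓖'.rightTranslationInvOf (χ.toFun g) hq' ∘ χ.fiberMap q := by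
  funext h
  exact (χ.map_mul _).trans (𝓖'.mul_congr (χ.toFun_inv _) rfl _ _)

end Hom

end LieGroupoid

/-! ### Tangent maps of a commutative square. -/

/-- The chain rule for two factorisations of one map, with the intermediate points replaced by
equal ones. -/
theorem mfderiv_comm_square {E A F B F' B' E' A' : Type*}
    [NormedAddCommGroup E] [NormedSpace ℝ E] [TopologicalSpace A] [ChartedSpace E A]
    [NormedAddCommGroup F] [NormedSpace ℝ F] [TopologicalSpace B] [ChartedSpace F B]
    [NormedAddCommGroup F'] [NormedSpace ℝ F'] [TopologicalSpace B'] [ChartedSpace F' B']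
    [NormedAddCommGroup E'] [NormedSpace ℝ E'] [TopologicalSpace A'] [ChartedSpace E' A']
    {u : A → B} {χ : B → B'} {φ : A → A'} {u' : A' → B'} {a : A} {b : B} {a' : A'}
    (hb : u a = b) (ha' : φ a = a') (hcomm : χ ∘ u = u' ∘ φ)
    (hu : MDifferentiable 𝓘(ℝ, E) 𝓘(ℝ, F) u) (hχ : MDifferentiable 𝓘(ℝ, F) 𝓘(ℝ, F') χ)
    (hφ : MDifferentiable 𝓘(ℝ, E) 𝓘(ℝ, E') φ) (hu' : MDifferentiable 𝓘(ℝ, E') 𝓘(ℝ, F') u')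
    (v : E) :
    (show F →L[ℝ] F' from mfderiv 𝓘(ℝ, F) 𝓘(ℝ, F') χ b)
      ((show E →L[ℝ] F from mfderiv 𝓘(ℝ, E) 𝓘(ℝ, F) u a) v) =
    (show E' →L[ℝ] F' from mfderiv 𝓘(ℝ, E') 𝓘(ℝ, F') u' a')
      ((show E →L[ℝ] E' from mfderiv 𝓘(ℝ, E) 𝓘(ℝ, E') φ a) v) := by
  -- The derivatives are viewed between model spaces, so b and a' need only be propositionally equal
  -- to the intermediate points. After substitution both sides are chain-rule expansions of the same
  -- composite.
  subst hb ha'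
  have h1 := mfderiv_comp a (hχ (u a)) (hu a)
  have h2 := mfderiv_comp a (hu' (φ a)) (hφ a)
  rw [hcomm] at h1
  exact congrArg (fun T : E →L[ℝ] F' => T v) (h1.symm.trans h2)

/-! ### Pull-back and the source and target maps of the cotangent groupoid. -/

namespace LieGroupoid

namespace Hom

variable {EG EQ G Q EG' EQ' G' Q' : Type*} [NormedAddCommGroup EG] [NormedSpace ℝ EG]
  [NormedAddCommGroup EQ] [NormedSpace ℝ EQ] [TopologicalSpace G] [ChartedSpace EG G]
  [IsManifold 𝓘(ℝ, EG) ∞ G] [TopologicalSpace Q] [ChartedSpace EQ Q]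
  [NormedAddCommGroup EG'] [NormedSpace ℝ EG']
  [NormedAddCommGroup EQ'] [NormedSpace ℝ EQ'] [TopologicalSpace G'] [ChartedSpace EG' G']
  [IsManifold 𝓘(ℝ, EG') ∞ G'] [TopologicalSpace Q'] [ChartedSpace EQ' Q']
  {𝓖 : LieGroupoid EG EQ G Q} {𝓖' : LieGroupoid EG' EQ' G' Q'} (χ : Hom 𝓖 𝓖')

/-- Composability in the cotangent groupoid is reflected by `χ^*`-relatedness, as soon as the base
points are composable. -/
theorem cotangentSrc_eq_cotangentTgt {μ ν : Cotangent EG G} {μ' ν' : Cotangent EG' G'}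
    (hμ : CotangentRelated χ.toFun μ μ') (hν : CotangentRelated χ.toFun ν ν')
    (hq : 𝓖.src μ.proj = 𝓖.tgt ν.proj) (h : 𝓖'.cotangentSrc μ' = 𝓖'.cotangentTgt ν') :
    𝓖.cotangentSrc μ = 𝓖.cotangentTgt ν := by
  obtain ⟨μ₁, rfl, hμ₁⟩ := hμ
  obtain ⟨ν₁, rfl, hν₁⟩ := hν
  -- Both sides of `h` are moved over the single point `χ.base (𝓖.tgt ν.proj)`; the equality in the
  -- total space A*G' then becomes an equality of functionals on one fibre, `h3`.
  have h1 : 𝓖'.src (χ.toFun μ.proj) = χ.base (𝓖.tgt ν.proj) :=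
    (χ.src_toFun _).trans (congrArg χ.base hq)
  have h2 := χ.tgt_toFun ν.proj
  rw [cotangentSrc_eq _ _ h1, cotangentTgt_eq _ _ h2] at h
  rw [𝓖.cotangentSrc_eq μ hq, 𝓖.cotangentTgt_eq ν rfl]
  have h3 := Bundle.TotalSpace.mk_injective _ h
  refine congrArg _ (ContinuousLinearMap.ext fun v => ?_)
  have hχ := χ.contMDiff_toFun.mdifferentiable (by simp)
  have hφ := (χ.contMDiff_fiberMap (𝓖.tgt ν.proj)).mdifferentiable (by simp)
  have h4 := mfderiv_comm_square (𝓖.rightTranslationInvOf_unitPoint μ.proj hq)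
    (χ.fiberMap_unitPoint _) (χ.toFun_rightTranslationInvOf μ.proj hq h1)
    ((𝓖.contMDiff_rightTranslationInvOf _ _).mdifferentiable (by simp)) hχ hφ
    ((𝓖'.contMDiff_rightTranslationInvOf _ _).mdifferentiable (by simp)) v
  have h5 := mfderiv_comm_square (𝓖.leftTranslationOf_unitPoint ν.proj rfl)
    (χ.fiberMap_unitPoint _) (χ.toFun_leftTranslationOf ν.proj rfl h2)
    ((𝓖.contMDiff_leftTranslationOf _ _).mdifferentiable (by simp)) hχ hφ
    ((𝓖'.contMDiff_leftTranslationOf _ _).mdifferentiable (by simp)) v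
  -- Evaluation at Aχ(v), the vector produced by both squares `h4` and `h5`.
  have h6 := congrArg (fun T : Unit × 𝓖'.src_submersion.complement →L[ℝ] ℝ => T
    ((show Unit × 𝓖.src_submersion.complement →L[ℝ] Unit × 𝓖'.src_submersion.complement from
      mfderiv 𝓘(ℝ, Unit × 𝓖.src_submersion.complement)
      𝓘(ℝ, Unit × 𝓖'.src_submersion.complement) (χ.fiberMap (𝓖.tgt ν.proj))
      (𝓖.unitPoint (𝓖.tgt ν.proj))) v)) h3
  have h7 := (hμ₁ _).trans (congrArg (show EG' →L[ℝ] ℝ from μ₁) h4)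
  have h8 := (hν₁ _).trans (congrArg (show EG' →L[ℝ] ℝ from ν₁) h5)
  exact ((map_neg (show EG →L[ℝ] ℝ from μ.snd) _).trans (congrArg Neg.neg h7)).trans
    (((map_neg (show EG' →L[ℝ] ℝ from μ₁) _).symm.trans h6).trans h8.symm)

end Hom

/-! ### Restriction to composable pairs and pull-back of generated covectors. -/

section Composable

variable {EG EQ G Q EG' EQ' G' Q' : Type*} [NormedAddCommGroup EG] [NormedSpace ℝ EG]
  [NormedAddCommGroup EQ] [NormedSpace ℝ EQ] [TopologicalSpace G] [ChartedSpace EG G]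
  [IsManifold 𝓘(ℝ, EG) ∞ G] [TopologicalSpace Q] [ChartedSpace EQ Q]
  [NormedAddCommGroup EG'] [NormedSpace ℝ EG']
  [NormedAddCommGroup EQ'] [NormedSpace ℝ EQ'] [TopologicalSpace G'] [ChartedSpace EG' G']
  [IsManifold 𝓘(ℝ, EG') ∞ G'] [TopologicalSpace Q'] [ChartedSpace EQ' Q']
  {𝓖 : LieGroupoid EG EQ G Q} {𝓖' : LieGroupoid EG' EQ' G' Q'}

theorem contMDiff_inclComposable :
    ContMDiff 𝓘(ℝ, EG × 𝓖.src_submersion.complement) 𝓘(ℝ, 𝓖.SrcProlongationModel) ∞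
      𝓖.inclComposable :=
  FiberProduct.contMDiff_mk
    (FiberProduct.contMDiff_mk FiberProduct.contMDiff_fst FiberProduct.contMDiff_fst)
    FiberProduct.contMDiff_snd

theorem inclComposable_injective : Function.Injective 𝓖.inclComposable := fun _ _ h =>
  FiberProduct.ext (congrArg (fun z => z.fst.fst) h) (congrArg (fun z => z.snd) h)

/-- A smooth map `P^α G → P^α' G'` that sends `G₂` into `G₂'` restricts to a smooth map
`G₂ → G₂'`. -/
theorem exists_contMDiff_restrict {χ : 𝓖.SrcProlongationSpace → 𝓖'.SrcProlongationSpace}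
    (hχ : ContMDiff 𝓘(ℝ, 𝓖.SrcProlongationModel) 𝓘(ℝ, 𝓖'.SrcProlongationModel) ∞ χ)
    (hr : ∀ z, χ (𝓖.inclComposable z) ∈ Set.range 𝓖'.inclComposable) :
    ∃ φ : 𝓖.Composable → 𝓖'.Composable,
      ContMDiff 𝓘(ℝ, EG × 𝓖.src_submersion.complement)
        𝓘(ℝ, EG' × 𝓖'.src_submersion.complement) ∞ φ ∧
      χ ∘ 𝓖.inclComposable = 𝓖'.inclComposable ∘ φ := by
  choose φ hφ using hr
  have h := hχ.comp 𝓖.contMDiff_inclComposable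
  have he : χ ∘ 𝓖.inclComposable = 𝓖'.inclComposable ∘ φ := funext fun z => (hφ z).symm
  refine ⟨φ, ?_, he⟩
  rw [he] at h
  -- Smoothness of φ is read off i' ∘ φ: the first and last entries of (g, g, h) are the two
  -- components of (g, h).
  have h1 := FiberProduct.contMDiff_fst (hf := 𝓖'.contMDiff_tgt_snd 𝓖'.src_submersion)
    (hp := 𝓖'.src_submersion)
  have h2 := FiberProduct.contMDiff_snd (hf := 𝓖'.contMDiff_tgt_snd 𝓖'.src_submersion)
    (hp := 𝓖'.src_submersion)
  have h3 := FiberProduct.contMDiff_fst (hf := 𝓖'.src_submersion.contMDiff)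
    (hp := 𝓖'.src_submersion)
  have h4 := h3.comp (h1.comp h)
  have h5 := h2.comp h
  exact FiberProduct.contMDiff_mk h4 h5

/-- A covector `χ^*`-related to one generated by `L'` is generated by `L = L' ∘ χ`. -/
theorem mem_generatedSubmanifold_of_related
    {χ : 𝓖.SrcProlongationSpace → 𝓖'.SrcProlongationSpace}
    (hχ : ContMDiff 𝓘(ℝ, 𝓖.SrcProlongationModel) 𝓘(ℝ, 𝓖'.SrcProlongationModel) ∞ χ)
    (hr : ∀ z, χ (𝓖.inclComposable z) ∈ Set.range 𝓖'.inclComposable)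
    {L : 𝓖.Composable → ℝ} {L' : 𝓖'.Composable → ℝ}
    (hL' : MDifferentiable 𝓘(ℝ, EG' × 𝓖'.src_submersion.complement) 𝓘(ℝ, ℝ) L')
    (hχL : ∀ z z', χ (𝓖.inclComposable z) = 𝓖'.inclComposable z' → L z = L' z')
    {μ : Cotangent 𝓖.SrcProlongationModel 𝓖.SrcProlongationSpace}
    {μ' : Cotangent 𝓖'.SrcProlongationModel 𝓖'.SrcProlongationSpace}
    {z : 𝓖.Composable} (hz : μ.proj = 𝓖.inclComposable z)
    (hμ : CotangentRelated χ μ μ') (hμ' : μ' ∈ 𝓖'.generatedSubmanifold L') :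
    μ ∈ 𝓖.generatedSubmanifold L := by
  obtain ⟨φ, hφ, he⟩ := exists_contMDiff_restrict hχ hr
  obtain ⟨x, μ₀⟩ := μ
  subst hz
  obtain ⟨ν, rfl, hν⟩ := hμ
  obtain ⟨z', ν', h1, h2⟩ := hμ'
  -- Membership in Σ_{L'} only supplies some base pair z'; injectivity of i' identifies it with
  -- φ(z).
  have hz' : φ z = z' := 𝓖'.inclComposable_injective
    ((congrFun he z).symm.trans (congrArg Bundle.TotalSpace.proj h1))
  refine ⟨z, μ₀, rfl, fun v => ?_⟩
  have hφd := hφ.mdifferentiable (by simp)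
  have h3 := mfderiv_comm_square rfl hz' he
    (𝓖.contMDiff_inclComposable.mdifferentiable (by simp)) (hχ.mdifferentiable (by simp)) hφd
    (𝓖'.contMDiff_inclComposable.mdifferentiable (by simp)) v
  have hLe : L = L' ∘ φ := funext fun w => hχL w (φ w) (congrFun he w)
  subst hLe
  -- Reading the fibre component as a functional on the fixed model space turns `h1` into ν = ν'
  -- without a heterogeneous equality.
  have h4 := congrArg (fun t : Cotangent 𝓖'.SrcProlongationModel 𝓖'.SrcProlongationSpace =>
    (show 𝓖'.SrcProlongationModel →L[ℝ] ℝ from t.snd)) h1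
  subst hz'
  have h5 := congrArg (fun T : EG × 𝓖.src_submersion.complement →L[ℝ] ℝ => T v)
    (mfderiv_comp z (hL' (φ z)) (hφd z))
  have h6 := (hν _).trans (congrArg (show 𝓖'.SrcProlongationModel →L[ℝ] ℝ from ν) h3)
  -- μ₀(Ti v) = ν(Ti'(Tφ v)) = ν'(Ti'(Tφ v)) = dL'(Tφ v) = d(L' ∘ φ)(v).
  exact h6.trans ((congrArg (fun T : 𝓖'.SrcProlongationModel →L[ℝ] ℝ => T _) h4).trans
    ((h2 _).trans h5.symm))

end Composable

end LieGroupoid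

/-! ### The theorem. -/

theorem mainTheorem6 {EG EQ G Q EG' EQ' G' Q' : Type*}
    [NormedAddCommGroup EG] [NormedSpace ℝ EG] [FiniteDimensional ℝ EG]
    [NormedAddCommGroup EQ] [NormedSpace ℝ EQ] [FiniteDimensional ℝ EQ]
    [TopologicalSpace G] [ChartedSpace EG G] [IsManifold 𝓘(ℝ, EG) ∞ G]
    [TopologicalSpace Q] [ChartedSpace EQ Q] [IsManifold 𝓘(ℝ, EQ) ∞ Q]
    [NormedAddCommGroup EG'] [NormedSpace ℝ EG'] [FiniteDimensional ℝ EG']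
    [NormedAddCommGroup EQ'] [NormedSpace ℝ EQ'] [FiniteDimensional ℝ EQ']
    [TopologicalSpace G'] [ChartedSpace EG' G'] [IsManifold 𝓘(ℝ, EG') ∞ G']
    [TopologicalSpace Q'] [ChartedSpace EQ' Q'] [IsManifold 𝓘(ℝ, EQ') ∞ Q']
    (𝓖 : LieGroupoid EG EQ G Q) (𝓖' : LieGroupoid EG' EQ' G' Q')
    (L : 𝓖.Composable → ℝ)
    (hL : MDifferentiable 𝓘(ℝ, EG × 𝓖.src_submersion.complement) 𝓘(ℝ, ℝ) L)
    (L' : 𝓖'.Composable → ℝ)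
    (hL' : MDifferentiable 𝓘(ℝ, EG' × 𝓖'.src_submersion.complement) 𝓘(ℝ, ℝ) L')
    (χ : LieGroupoid.Hom 𝓖.srcProlongation 𝓖'.srcProlongation)
    (hχ : Set.range 𝓖.inclComposable = χ.toFun ⁻¹' Set.range 𝓖'.inclComposable)
    (hχL : ∀ z z', χ.toFun (𝓖.inclComposable z) = 𝓖'.inclComposable z' → L z = L' z')
    {n : ℕ} (g : Fin (n + 1) → G)
    (γ : Fin n → Cotangent 𝓖.SrcProlongationModel 𝓖.SrcProlongationSpace)
    (g' : Fin (n + 1) → G')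
    (γ' : Fin n → Cotangent 𝓖'.SrcProlongationModel 𝓖'.SrcProlongationSpace)
    (hγ : 𝓖.IsSequenceOver g γ) (hγ' : 𝓖'.IsSequenceOver g' γ')
    (hγγ' : ∀ k, CotangentRelated χ.toFun (γ k) (γ' k))
    (hdyn : 𝓖'.SatisfiesDynamics L' γ') :
    𝓖.SatisfiesDynamics L γ := by
  refine ⟨fun k => ?_, fun k k' hk => ?_⟩
  · obtain ⟨h, hz⟩ := hγ k
    exact LieGroupoid.mem_generatedSubmanifold_of_related χ.contMDiff_toFun
      (fun z => hχ.subset ⟨z, rfl⟩) hL' hχL hz (hγγ' k) (hdyn.1 k)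
  · refine χ.cotangentSrc_eq_cotangentTgt (hγγ' k') (hγγ' k) ?_ (hdyn.2 k k' hk)
    -- The base points match because consecutive pairs share an arrow: with k' = k + 1,
    -- `k'.castSucc` and `k.succ` are the same index.
    obtain ⟨h, hz⟩ := hγ k
    obtain ⟨h', hz'⟩ := hγ k'
    rw [hz, hz']
    exact congrArg g (Fin.ext hk.symm)
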